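/- Let $n \ge 1$ and let $\mathcal R \subset \mathbb C^n$ be a bounded complete Reinhardt domain, i.e. a bounded, nonempty, connected open set such that $(z_1,\dots,z_n)\in\mathcal R$ implies $(\lambda_1 z_1,\dots,\lambda_n z_n)\in\mathcal R$ for all $\lambda_k\in\mathbb C$ with $|\lambda_k|<1$. Let $H^1(\mathcal R)$ be the set of holomorphic functions $f$ on $\mathcal R$ with $$\|f\|_{H^1(\mathcal R)}=\sup_{\mathbf r\in\mathcal F}\int_{[0,2\pi]^n}\bigl|f(r_1e^{i\theta_1},\dots,r_ne^{i\theta_n})\bigr|\,d\theta_1\cdots d\theta_n<\infty,$$ where $\mathcal F$ is the set of $\mathbf r=(r_1,\dots,r_n)$ with all $r_j>0$ such that the torus $\{z\in\mathbb C^n : |z_j|=r_j,\ j=1,\dots,n\}$ is contained in $\mathcal R$. Let $A^1(\mathcal R)$ be the set of holomorphic functions $f$ on $\mathcal R$ with $\|f\|_{A^1(\mathcal R)}=\int_{\mathcal R}|f|\,dV<\infty$, where $dV$ is Lebesgue measure on $\mathbb C^n$. Let $f\in H^1(\mathcal R)$. Then $f$ has a unique power series expansion $f(z)=\sum_{\alpha\in\mathbb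 N^n}b_\alpha z^\alpha$ converging uniformly on compact subsets of $\mathcal R$ (here $0\in\mathbb N$). Moreover $f$ and, for every $N\ge 0$, the square partial sum $$S_Nf(z)=\sum_{|\alpha|_\infty\le N}b_\alpha z^\alpha,\qquad |\alpha|_\infty=\max_{1\le j\le n}\alpha_j,$$ belong to $A^1(\mathcal R)$, and $$\|S_Nf-f\|_{A^1(\mathcal R)}\longrightarrow 0\qquad\text{as } N\to\infty.$$ -/

import Mathlib

open MeasureTheory Filter Topology
open scoped ENNReal

noncomputable section

/-- A bounded complete Reinhardt domain in `ℂⁿ`: a bounded domain (open, connected, nonempty set)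
which is stable under all multiplications `(z₁, …, zₙ) ↦ (λ₁ z₁, …, λₙ zₙ)` with `|λₖ| < 1`. -/
structure IsBoundedCompleteReinhardtDomain {n : ℕ} (R : Set (Fin n → ℂ)) : Prop where
  isOpen : IsOpen R
  isConnected : IsConnected R
  isBounded : Bornology.IsBounded R
  mul_mem : ∀ z ∈ R, ∀ c : Fin n → ℂ, (∀ k, ‖c k‖ < 1) → (fun k => c k * z k) ∈ R

/-- The set of multiradii `r` (with positive entries) such that the torus
`r · 𝕋ⁿ = {z : |z_j| = r_j for all j}` is contained in `R`. -/
def torusRadii {n : ℕ} (R : Set (Fin n → ℂ)) : Set (Fin n → ℝ) :=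
  {r | (∀ j, 0 < r j) ∧ ∀ z : Fin n → ℂ, (∀ j, ‖z j‖ = r j) → z ∈ R}

/-- The (extended) norm of `H¹(R)`: the supremum over all tori `r · 𝕋ⁿ ⊆ R` of
`∫_{[0, 2π]ⁿ} |f(r₁ e^{iθ₁}, …, rₙ e^{iθₙ})| dθ₁ ⋯ dθₙ`. -/
def hardyNorm {n : ℕ} (R : Set (Fin n → ℂ)) (f : (Fin n → ℂ) → ℂ) : ℝ≥0∞ :=
  ⨆ r ∈ torusRadii R,
    ∫⁻ θ in Set.Icc (0 : Fin n → ℝ) (fun _ => 2 * Real.pi), ‖f (torusMap 0 r θ)‖ₑ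

/-- `f ∈ H¹(R)`: `f` is holomorphic on `R` with finite `H¹(R)` norm. -/
def MemHardy {n : ℕ} (R : Set (Fin n → ℂ)) (f : (Fin n → ℂ) → ℂ) : Prop :=
  DifferentiableOn ℂ f R ∧ hardyNorm R f < ∞

/-- The (extended) norm of `A¹(R)`: the integral of `|f|` over `R` for Lebesgue measure. -/
def bergmanNorm {n : ℕ} (R : Set (Fin n → ℂ)) (f : (Fin n → ℂ) → ℂ) : ℝ≥0∞ :=
  ∫⁻ z in R, ‖f z‖ₑ

/-- `f ∈ A¹(R)`: `f` is holomorphic on `R` with finite `A¹(R)` norm. -/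
def MemBergman {n : ℕ} (R : Set (Fin n → ℂ)) (f : (Fin n → ℂ) → ℂ) : Prop :=
  DifferentiableOn ℂ f R ∧ bergmanNorm R f < ∞

/-- `f(z) = ∑_α b_α z^α` on `R`, the series being summed over all multi-indices `α ∈ ℕⁿ` and
converging uniformly on compact subsets of `R`. -/
def IsPowerSeriesExpansion {n : ℕ} (R : Set (Fin n → ℂ)) (f : (Fin n → ℂ) → ℂ)
    (b : (Fin n → ℕ) → ℂ) : Prop :=
  ∀ K ⊆ R, IsCompact K →
    HasSumUniformlyOn (fun (α : Fin n → ℕ) (z : Fin n → ℂ) => b α * ∏ j, z j ^ α j) f K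

/-- The square partial sum `∑_{|α|_∞ ≤ N} b_α z^α` of the power series with coefficients `b`. -/
def squarePartialSum {n : ℕ} (b : (Fin n → ℕ) → ℂ) (N : ℕ) (z : Fin n → ℂ) : ℂ :=
  ∑ α ∈ Fintype.piFinset (fun _ : Fin n => Finset.range (N + 1)), b α * ∏ j, z j ^ α j

end

/-!
The square partial sums `S_N f` of a Hardy space function are in general unbounded in the Hardy
norm. On each torus they are bounded uniformly in `N`, however, with a loss which is only logarithmic
in the distance to the boundary, and this loss is integrable over the domain.

*Expansion.* On a polydisc around the origin with closure in `R`, iterating Cauchy's formula in one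
variable (`integral_mul_prod_inv_one_sub_div`) and expanding the Cauchy kernels gives an absolutely
convergent power series (`hasSumUniformlyOn_taylorCoeff`). Every point of `R` lies in such a polydisc.
If a series converges to `f` uniformly on the torus through `w`, then `b_α w^α` is a Fourier
coefficient of `f` on this torus (`mul_prod_pow_eq_torusCoeff`). This yields the uniqueness, and the
independence of the coefficients of the polydisc.

*Bounds on tori.* If `z = q w` with `w ∈ R` and `0 < q < 1`, then `S_N f` on the torus through `z` is
the convolution of `f` on the torus through `w` with `∏_j ∑_{k ≤ N} (q e^{2πi t_j})^k`. Each factor is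
bounded by `2 / |1 - q e^{2πi t}|`, so its `L¹` norm is `O(log (1 / (1 - q)))` uniformly in `N`
(`integral_norm_sum_pow_unitExp_le`). Hence the average of `|S_N f|` over the torus through `z` is at
most a constant times `log (1 / (1 - q))ⁿ` times the Hardy norm of `f`.

*Integration.* Lebesgue measure is rotation invariant, so the Bergman norm of `S_N f - f` is the
integral over `R` of its averages over tori. These tend to `0` pointwise. With `q = 1 - 2^{-(k+1)}`,
the averages at points of `q R` are `O(kⁿ)`, while the volume of `R \ q R` is `O(2^{-k})`
(`volume_sdiff_smul_le`); so they have an integrable majorant (`lintegral_majorant_lt_top`), and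
dominated convergence applies.
-/

/-! ### Rotations and the geometry of complete Reinhardt domains -/

section

/-- The character `t ↦ e^{2πit}` of the circle `ℝ/ℤ`, with values in `ℂ`. -/
noncomputable def unitExp (t : UnitAddCircle) : ℂ := AddCircle.toCircle t

@[simp] lemma norm_unitExp (t : UnitAddCircle) : ‖unitExp t‖ = 1 := Circle.norm_coe _

@[simp] lemma unitExp_ne_zero (t : UnitAddCircle) : unitExp t ≠ 0 := Circle.coe_ne_zero _

lemma unitExp_add (s t : UnitAddCircle) : unitExp (s + t) = unitExp s * unitExp t := by
  simp [unitExp, AddCircle.toCircle_add]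

lemma unitExp_sub (s t : UnitAddCircle) : unitExp (s - t) = unitExp s * (unitExp t)⁻¹ := by
  simp [unitExp, sub_eq_add_neg, AddCircle.toCircle_add, AddCircle.toCircle_neg]

lemma unitExp_coe (θ : ℝ) : unitExp (θ : UnitAddCircle) =
    Complex.exp ((2 * Real.pi * θ : ℝ) * Complex.I) := by
  simp [unitExp, AddCircle.toCircle_apply_mk]

@[fun_prop]
lemma continuous_unitExp : Continuous unitExp :=
  continuous_induced_dom.comp AddCircle.continuous_toCircle

lemma fourier_eq_unitExp_zpow (k : ℤ) (t : UnitAddCircle) : fourier k t = unitExp t ^ k := by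
  simp [unitExp, AddCircle.toCircle_zsmul]

instance : IsProbabilityMeasure (volume : Measure UnitAddCircle) := ⟨UnitAddCircle.measure_univ⟩

variable {n : ℕ}

/-- The action of the torus `(ℝ/ℤ)ⁿ` on `ℂⁿ` by rotation of the coordinates. -/
noncomputable def rotate (x : Fin n → UnitAddCircle) (z : Fin n → ℂ) : Fin n → ℂ :=
  fun j => unitExp (x j) * z j

@[simp] lemma rotate_apply (x : Fin n → UnitAddCircle) (z : Fin n → ℂ) (j : Fin n) :
    rotate x z j = unitExp (x j) * z j := rfl

lemma rotate_add (x y : Fin n → UnitAddCircle) (z : Fin n → ℂ) :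
    rotate (x + y) z = rotate x (rotate y z) := by
  ext j; simp [unitExp_add, mul_assoc]

lemma continuous_rotate : Continuous fun p : (Fin n → UnitAddCircle) × (Fin n → ℂ) =>
    rotate p.1 p.2 := by
  unfold rotate; fun_prop

lemma continuous_rotate_left (z : Fin n → ℂ) : Continuous fun x => rotate x z := by
  unfold rotate; fun_prop

namespace IsBoundedCompleteReinhardtDomain

variable {R : Set (Fin n → ℂ)}

lemma exists_radii_gt (hR : IsBoundedCompleteReinhardtDomain R) {z : Fin n → ℂ} (hz : z ∈ R) :
    ∃ r : Fin n → ℝ, (∀ j, ‖z j‖ < r j) ∧ ∃ w ∈ R, ∀ j, ‖w j‖ = r j := by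
  obtain ⟨ε, hε, hball⟩ := Metric.isOpen_iff.1 hR.isOpen z hz
  have hu : ∀ j, ∃ u : ℂ, ‖u‖ = 1 ∧ z j = ‖z j‖ * u := by
    intro j
    by_cases h : z j = 0
    · exact ⟨1, by simp, by simp [h]⟩
    · refine ⟨z j / ‖z j‖, by simp [h], ?_⟩
      have : (‖z j‖ : ℂ) ≠ 0 := by simpa using h
      field_simp
  choose u hu1 hu2 using hu
  refine ⟨fun j => ‖z j‖ + ε / 2, fun j => by linarith, fun j => (‖z j‖ + ε / 2 : ℝ) * u j,
    hball ?_, fun j => ?_⟩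
  · rw [Metric.mem_ball, dist_pi_lt_iff hε]
    intro j
    have : ((‖z j‖ + ε / 2 : ℝ) : ℂ) * u j - z j = (ε / 2 : ℝ) * u j := by
      nth_rw 2 [hu2 j]; push_cast; ring
    rw [dist_eq_norm, this, norm_mul, hu1, mul_one, Complex.norm_real, Real.norm_of_nonneg] <;>
      linarith
  · rw [norm_mul, hu1, mul_one, Complex.norm_real, Real.norm_of_nonneg]
    positivity

lemma mem_of_norm_lt (hR : IsBoundedCompleteReinhardtDomain R) {z w : Fin n → ℂ} (hw : w ∈ R)
    (h : ∀ j, ‖z j‖ < ‖w j‖) : z ∈ R := by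
  have hw0 : ∀ j, w j ≠ 0 := fun j h0 => by
    have := h j
    rw [h0, norm_zero] at this
    exact absurd this (not_lt.2 (norm_nonneg _))
  have := hR.mul_mem w hw (fun j => z j / w j) fun j => by
    rw [norm_div, div_lt_one (norm_pos_iff.2 (hw0 j))]; exact h j
  convert this using 1
  ext j
  exact (div_mul_cancel₀ _ (hw0 j)).symm

/-- A complete Reinhardt domain is also stable under shrinking the moduli in the weak sense, because
it is open. -/
lemma mem_of_norm_le (hR : IsBoundedCompleteReinhardtDomain R) {z w : Fin n → ℂ} (hw : w ∈ R)
    (h : ∀ j, ‖z j‖ ≤ ‖w j‖) : z ∈ R := by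
  obtain ⟨r, hr, v, hv, hvr⟩ := hR.exists_radii_gt hw
  exact hR.mem_of_norm_lt hv fun j => by rw [hvr]; exact (h j).trans_lt (hr j)

/-- Every point of `R` lies in an open polydisc around the origin whose closure lies in `R`. -/
lemma exists_ofReal_mem_gt (hR : IsBoundedCompleteReinhardtDomain R) {z : Fin n → ℂ} (hz : z ∈ R) :
    ∃ r : Fin n → ℝ, (∀ j, ‖z j‖ < r j) ∧ (fun j => (r j : ℂ)) ∈ R := by
  obtain ⟨r, hr, v, hv, hvr⟩ := hR.exists_radii_gt hz
  refine ⟨r, hr, hR.mem_of_norm_le hv fun j => ?_⟩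
  rw [Complex.norm_real, Real.norm_of_nonneg ((norm_nonneg _).trans (hr j).le), hvr]

lemma rotate_mem (hR : IsBoundedCompleteReinhardtDomain R) {z : Fin n → ℂ} (hz : z ∈ R)
    (x : Fin n → UnitAddCircle) : rotate x z ∈ R :=
  hR.mem_of_norm_le hz fun j => by simp

lemma rotate_mem_iff (hR : IsBoundedCompleteReinhardtDomain R) {z : Fin n → ℂ}
    (x : Fin n → UnitAddCircle) : rotate x z ∈ R ↔ z ∈ R :=
  ⟨fun h => hR.mem_of_norm_le h fun j => by simp, fun h => hR.rotate_mem h x⟩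

lemma zero_mem (hR : IsBoundedCompleteReinhardtDomain R) : (0 : Fin n → ℂ) ∈ R := by
  obtain ⟨z, hz⟩ := hR.isConnected.nonempty
  exact hR.mem_of_norm_le hz fun j => by simp

lemma continuous_comp_rotate (hR : IsBoundedCompleteReinhardtDomain R) {f : (Fin n → ℂ) → ℂ}
    (hf : ContinuousOn f R) {z : Fin n → ℂ} (hz : z ∈ R) : Continuous fun x => f (rotate x z) :=
  hf.comp_continuous (continuous_rotate_left z) fun x => hR.rotate_mem hz x

end IsBoundedCompleteReinhardtDomain

lemma measurePreserving_rotate (x : Fin n → UnitAddCircle) :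
    MeasurePreserving (rotate x : (Fin n → ℂ) → Fin n → ℂ) :=
  volume_preserving_pi fun j => (rotation (AddCircle.toCircle (x j))).measurePreserving

/-- Lebesgue measure on `ℂⁿ` is rotation invariant, so that an integrand may be replaced by its
averages over the tori. -/
lemma lintegral_eq_lintegral_lintegral_rotate {F : (Fin n → ℂ) → ℝ≥0∞} (hF : Measurable F) :
    ∫⁻ z, F z = ∫⁻ z, ∫⁻ x, F (rotate x z) := by
  rw [lintegral_lintegral_swap]
  · simp_rw [(measurePreserving_rotate _).lintegral_comp hF]
    simp
  · exact (hF.comp (continuous_rotate.measurable.comp measurable_swap)).aemeasurable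

/-! ### Cauchy's formula on polydiscs -/

lemma integral_unitExp_mul_eq_circleAverage (g : ℂ → ℂ) (r : ℝ) :
    ∫ t : UnitAddCircle, g (unitExp t * r) = Real.circleAverage g 0 r := by
  rw [← UnitAddCircle.intervalIntegral_preimage 0, Real.circleAverage_def]
  have := intervalIntegral.integral_comp_mul_left (a := 0) (b := 1)
    (fun θ => g (circleMap 0 r θ)) Real.two_pi_pos.ne'
  rw [mul_zero, mul_one] at this
  rw [← this, zero_add]
  congr 1
  ext θ
  rw [unitExp_coe, circleMap_zero, mul_comm]

/-- Cauchy's formula on a disc, as an average over the circle group. -/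
lemma integral_mul_inv_one_sub_div {g : ℂ → ℂ} {r : ℝ}
    (hg : ∀ ζ, ‖ζ‖ ≤ r → DifferentiableAt ℂ g ζ) {z : ℂ} (hz : ‖z‖ < r) :
    ∫ t : UnitAddCircle, g (unitExp t * r) * (1 - z / (unitExp t * r))⁻¹ = g z := by
  have hr : 0 < r := (norm_nonneg _).trans_lt hz
  have hd : DiffContOnCl ℂ g (Metric.ball 0 |r|) := by
    refine DifferentiableOn.diffContOnCl fun ζ hζ => ?_
    rw [abs_of_pos hr] at hζ
    exact (hg ζ (by simpa using Metric.closure_ball_subset_closedBall hζ)).differentiableWithinAt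
  rw [← hd.circleAverage_smul_div (w := z) (by simpa [abs_of_pos hr] using hz),
    ← integral_unitExp_mul_eq_circleAverage]
  refine integral_congr_ae (Eventually.of_forall fun t => ?_)
  have h0 : unitExp t * (r : ℂ) ≠ 0 := mul_ne_zero (unitExp_ne_zero t) (by exact_mod_cast hr.ne')
  simp only [sub_zero, smul_eq_mul]
  rw [mul_comm]
  congr 1
  rw [one_sub_div h0, inv_div]

lemma norm_div_unitExp_mul {r : ℝ} (hr : 0 < r) (z : ℂ) (t : UnitAddCircle) :
    ‖z / (unitExp t * r)‖ = ‖z‖ / r := by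
  rw [norm_div, norm_mul, norm_unitExp, one_mul, Complex.norm_real, Real.norm_of_nonneg hr.le]

lemma one_sub_div_unitExp_mul_ne_zero {r : ℝ} {z : ℂ} (hz : ‖z‖ < r) (t : UnitAddCircle) :
    1 - z / (unitExp t * r) ≠ 0 := by
  have hr : 0 < r := (norm_nonneg _).trans_lt hz
  intro h
  have h1 := congrArg norm (sub_eq_zero.1 h)
  rw [norm_div_unitExp_mul hr, norm_one] at h1
  have := (div_lt_one hr).2 hz
  linarith

lemma continuous_inv_one_sub_div {r : ℝ} {z : ℂ} (hz : ‖z‖ < r) :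
    Continuous fun t : UnitAddCircle => (1 - z / (unitExp t * r))⁻¹ := by
  have hr : 0 < r := (norm_nonneg _).trans_lt hz
  refine Continuous.inv₀ (continuous_const.sub (continuous_const.div (by fun_prop) fun t => ?_))
    (one_sub_div_unitExp_mul_ne_zero hz)
  exact mul_ne_zero (unitExp_ne_zero t) (by exact_mod_cast hr.ne')

/-- Cauchy's formula on the coordinates in `s`, the other ones being frozen. The induction step
averages over the rotations of one more coordinate, under which the measure is invariant. -/
lemma IsBoundedCompleteReinhardtDomain.integral_mul_prod_inv_one_sub_div_finset
    {R : Set (Fin n → ℂ)} (hR : IsBoundedCompleteReinhardtDomain R) {f : (Fin n → ℂ) → ℂ}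
    (hf : DifferentiableOn ℂ f R) {r : Fin n → ℝ} (hr : (fun j => (r j : ℂ)) ∈ R)
    {z : Fin n → ℂ} (hz : ∀ j, ‖z j‖ < r j) (s : Finset (Fin n)) :
    ∫ x : Fin n → UnitAddCircle, f (fun j => if j ∈ s then unitExp (x j) * r j else z j) *
      ∏ j ∈ s, (1 - z j / (unitExp (x j) * r j))⁻¹ = f z := by
  have hr0 : ∀ j, 0 < r j := fun j => (norm_nonneg _).trans_lt (hz j)
  have hmem : ∀ w : Fin n → ℂ, (∀ j, ‖w j‖ ≤ r j) → w ∈ R := fun w hw =>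
    hR.mem_of_norm_le hr fun j => by
      rw [Complex.norm_real, Real.norm_of_nonneg (hr0 j).le]; exact hw j
  have hv : ∀ (s : Finset (Fin n)) (x : Fin n → UnitAddCircle) (j : Fin n),
      ‖if j ∈ s then unitExp (x j) * (r j : ℂ) else z j‖ ≤ r j := by
    intro s x j
    split_ifs
    · simp [abs_of_pos (hr0 j)]
    · exact (hz j).le
  have hcont : ∀ s : Finset (Fin n), Continuous fun x : Fin n → UnitAddCircle =>
      f (fun j => if j ∈ s then unitExp (x j) * r j else z j) *
        ∏ j ∈ s, (1 - z j / (unitExp (x j) * r j))⁻¹ := by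
    intro s
    refine Continuous.mul (hf.continuousOn.comp_continuous ?_ fun x => hmem _ (hv s x)) ?_
    · refine continuous_pi fun j => ?_
      split_ifs <;> fun_prop
    · exact continuous_finsetProd _ fun j _ =>
        (continuous_inv_one_sub_div (hz j)).comp (continuous_apply j)
  induction s using Finset.induction_on with
  | empty => simp
  | insert j s hj ih =>
    rw [← ih]
    set G : (Fin n → UnitAddCircle) → ℂ := fun x =>
      f (fun i => if i ∈ insert j s then unitExp (x i) * r i else z i) *
        ∏ i ∈ insert j s, (1 - z i / (unitExp (x i) * r i))⁻¹ with hG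
    have h1 : ∫ x, G x =
        ∫ t : UnitAddCircle, ∫ x, G (x + (Pi.single j t : Fin n → UnitAddCircle)) := by
      simp_rw [integral_add_right_eq_self]
      simp
    rw [h1, integral_integral_swap_of_hasCompactSupport _ (HasCompactSupport.of_compactSpace _)]
    swap
    · refine (hcont (insert j s)).comp (continuous_snd.add ?_)
      exact (continuous_single j).comp continuous_fst
    refine integral_congr_ae (Eventually.of_forall fun x => ?_)
    set v : Fin n → ℂ := fun i => if i ∈ s then unitExp (x i) * r i else z i with hv'
    have h2 : ∀ t, G (x + (Pi.single j t : Fin n → UnitAddCircle)) =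
        (f (Function.update v j (unitExp (x j + t) * r j)) *
          (1 - z j / (unitExp (x j + t) * r j))⁻¹) *
          ∏ i ∈ s, (1 - z i / (unitExp (x i) * r i))⁻¹ := by
      intro t
      rw [hG]
      simp only
      rw [Finset.prod_insert hj, ← mul_assoc]
      congr 1
      · congr 1
        · congr 1
          ext i
          by_cases hi : i = j
          · subst hi; simp
          · simp [hi, hv']
        · simp
      · refine Finset.prod_congr rfl fun i hi => ?_
        have : i ≠ j := fun h => hj (h ▸ hi)
        simp [this]
    simp only [h2]
    rw [integral_mul_const, integral_add_left_eq_self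
      (fun t => f (Function.update v j (unitExp t * r j)) * (1 - z j / (unitExp t * r j))⁻¹) (x j),
      integral_mul_inv_one_sub_div (g := fun ζ => f (Function.update v j ζ)) _ (hz j)]
    · congr 2
      rw [Function.update_eq_self_iff]
      simp [hv', hj]
    · intro ζ hζ
      refine ((hf _ (hmem _ fun i => ?_)).differentiableAt
        (hR.isOpen.mem_nhds (hmem _ fun i => ?_))).comp ζ
        (hasFDerivAt_update v ζ).differentiableAt
      all_goals
        by_cases hi : i = j
        · subst hi; simpa using hζ
        · simpa [hi] using hv s x i

/-- Cauchy's formula on a polydisc, as an average over a torus. -/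
lemma IsBoundedCompleteReinhardtDomain.integral_mul_prod_inv_one_sub_div
    {R : Set (Fin n → ℂ)} (hR : IsBoundedCompleteReinhardtDomain R) {f : (Fin n → ℂ) → ℂ}
    (hf : DifferentiableOn ℂ f R) {r : Fin n → ℝ} (hr : (fun j => (r j : ℂ)) ∈ R)
    {z : Fin n → ℂ} (hz : ∀ j, ‖z j‖ < r j) :
    ∫ x : Fin n → UnitAddCircle, f (rotate x fun j => (r j : ℂ)) *
      ∏ j, (1 - z j / (unitExp (x j) * r j))⁻¹ = f z := by
  simpa [rotate] using! hR.integral_mul_prod_inv_one_sub_div_finset hf hr hz Finset.univ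

/-! ### Power series expansions -/

/-- Translation by a half period changes the sign of the character. -/
lemma integral_unitExp_zpow {k : ℤ} (hk : k ≠ 0) : ∫ t : UnitAddCircle, unitExp t ^ k = 0 := by
  have h : ∫ t : UnitAddCircle, unitExp t ^ k = -∫ t : UnitAddCircle, unitExp t ^ k := by
    simp_rw [← fourier_eq_unitExp_zpow]
    conv_lhs => rw [← integral_add_right_eq_self _ ((1 / 2 / k : ℝ) : UnitAddCircle)]
    rw [← integral_neg]
    refine integral_congr_ae (Eventually.of_forall fun t => ?_)
    exact fourier_add_half_inv_index hk one_pos t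
  exact self_eq_neg.1 h

lemma integral_prod_unitExp_pow_mul_inv (β α : Fin n → ℕ) :
    ∫ x : Fin n → UnitAddCircle, (∏ j, unitExp (x j) ^ β j) * ∏ j, (unitExp (x j))⁻¹ ^ α j =
      if α = β then 1 else 0 := by
  have h : ∀ x : Fin n → UnitAddCircle,
      (∏ j, unitExp (x j) ^ β j) * ∏ j, (unitExp (x j))⁻¹ ^ α j =
        ∏ j, unitExp (x j) ^ ((β j : ℤ) - α j) := by
    intro x
    rw [← Finset.prod_mul_distrib]
    refine Finset.prod_congr rfl fun j _ => ?_
    rw [zpow_sub₀ (unitExp_ne_zero _), inv_pow, zpow_natCast, zpow_natCast, div_eq_mul_inv]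
  simp_rw [h]
  rw [integral_fintype_prod_volume_eq_prod (fun j t => unitExp t ^ ((β j : ℤ) - α j))]
  split_ifs with hαβ
  · subst hαβ; simp
  · obtain ⟨j, hj⟩ := Function.ne_iff.1 hαβ
    exact Finset.prod_eq_zero (Finset.mem_univ j) (integral_unitExp_zpow (by omega))

/-- The Fourier coefficient of index `α` of `f` on the torus through `w`. If `f = ∑ b_α z^α`, it
equals `b_α w^α`. -/
noncomputable def torusCoeff (f : (Fin n → ℂ) → ℂ) (w : Fin n → ℂ) (α : Fin n → ℕ) : ℂ :=
  ∫ x : Fin n → UnitAddCircle, f (rotate x w) * ∏ j, (unitExp (x j))⁻¹ ^ α j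

lemma continuous_prod_inv_unitExp_pow (α : Fin n → ℕ) :
    Continuous fun x : Fin n → UnitAddCircle => ∏ j, (unitExp (x j))⁻¹ ^ α j :=
  continuous_finsetProd _ fun j _ => (Continuous.inv₀ (by fun_prop) fun _ => by simp).pow _

lemma norm_prod_inv_unitExp_pow (α : Fin n → ℕ) (x : Fin n → UnitAddCircle) :
    ‖∏ j, (unitExp (x j))⁻¹ ^ α j‖ = 1 := by simp

lemma integrable_of_continuous {X E : Type*} [TopologicalSpace X] [CompactSpace X]
    [MeasurableSpace X] [OpensMeasurableSpace X] [NormedAddCommGroup E]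
    [SecondCountableTopologyEither X E] {μ : Measure X} [IsFiniteMeasure μ]
    {g : X → E} (hg : Continuous g) : Integrable g μ :=
  hg.integrable_of_hasCompactSupport (HasCompactSupport.of_compactSpace g)

/-- The coefficients of a series which converges uniformly on the torus through `w` are given by the
Fourier coefficients of its sum there. -/
lemma mul_prod_pow_eq_torusCoeff {f : (Fin n → ℂ) → ℂ} {b : (Fin n → ℕ) → ℂ} {w : Fin n → ℂ}
    (hf : Continuous fun x => f (rotate x w))
    (h : HasSumUniformlyOn (fun (α : Fin n → ℕ) (z : Fin n → ℂ) => b α * ∏ j, z j ^ α j) f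
      (Set.range fun x => rotate x w)) (α : Fin n → ℕ) :
    b α * ∏ j, w j ^ α j = torusCoeff f w α := by
  classical
  refine eq_of_forall_dist_le fun ε hε => ?_
  have hu := Metric.tendstoUniformlyOn_iff.1 h.tendstoUniformlyOn ε hε
  obtain ⟨s, hs, hα⟩ := (hu.and (eventually_ge_atTop ({α} : Finset (Fin n → ℕ)))).exists
  have hP : Continuous fun x : Fin n → UnitAddCircle =>
      ∑ β ∈ s, b β * ∏ j, rotate x w j ^ β j := by
    simp only [rotate_apply]
    fun_prop
  have h1 : b α * ∏ j, w j ^ α j = torusCoeff (fun z => ∑ β ∈ s, b β * ∏ j, z j ^ β j) w α := by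
    have h2 : ∀ (x : Fin n → UnitAddCircle) (β : Fin n → ℕ),
        (b β * ∏ j, rotate x w j ^ β j) * ∏ j, (unitExp (x j))⁻¹ ^ α j =
        (b β * ∏ j, w j ^ β j) *
          ((∏ j, unitExp (x j) ^ β j) * ∏ j, (unitExp (x j))⁻¹ ^ α j) := by
      intro x β
      simp only [rotate_apply, mul_pow, Finset.prod_mul_distrib]
      ring
    simp_rw [torusCoeff, Finset.sum_mul, h2]
    rw [integral_finsetSum]
    · simp_rw [integral_const_mul, integral_prod_unitExp_pow_mul_inv]
      simp [Finset.singleton_subset_iff.1 hα]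
    · intro β _
      refine integrable_of_continuous (continuous_const.mul (Continuous.mul ?_
        (continuous_prod_inv_unitExp_pow α)))
      fun_prop
  rw [h1, torusCoeff, torusCoeff, dist_eq_norm, ← integral_sub]
  · refine (norm_integral_le_of_norm_le_const (C := ε) (Eventually.of_forall fun x => ?_)).trans
      (by simp)
    rw [← sub_mul, norm_mul, norm_prod_inv_unitExp_pow, mul_one, ← dist_eq_norm, dist_comm]
    exact (hs _ ⟨x, rfl⟩).le
  · exact integrable_of_continuous (hP.mul (continuous_prod_inv_unitExp_pow α))
  · exact integrable_of_continuous (hf.mul (continuous_prod_inv_unitExp_pow α))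

/-- The square partial sums as convolutions with products of truncated geometric series. -/
lemma squarePartialSum_eq_integral {f : (Fin n → ℂ) → ℂ} {b : (Fin n → ℕ) → ℂ} {w : Fin n → ℂ}
    (hf : Continuous fun x => f (rotate x w))
    (hb : ∀ α, b α * ∏ j, w j ^ α j = torusCoeff f w α) (N : ℕ) (ζ : Fin n → ℂ) :
    squarePartialSum b N (fun j => ζ j * w j) =
      ∫ x : Fin n → UnitAddCircle, f (rotate x w) *
        ∏ j, ∑ k ∈ Finset.range (N + 1), (ζ j * (unitExp (x j))⁻¹) ^ k := by
  simp_rw [Finset.prod_univ_sum, Finset.mul_sum, mul_pow, Finset.prod_mul_distrib]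
  rw [integral_finsetSum, squarePartialSum]
  · refine Finset.sum_congr rfl fun α _ => ?_
    simp only [mul_pow, Finset.prod_mul_distrib]
    rw [mul_left_comm, hb, torusCoeff, ← integral_const_mul]
    refine integral_congr_ae (Eventually.of_forall fun x => ?_)
    exact mul_left_comm _ _ _
  · intro α _
    exact integrable_of_continuous (hf.mul (continuous_const.mul
      (continuous_prod_inv_unitExp_pow α)))

lemma tendsto_piFinset_range_atTop : Tendsto
    (fun N : ℕ => Fintype.piFinset fun _ : Fin n => Finset.range (N + 1)) atTop atTop := by
  refine tendsto_atTop_finset_of_monotone (fun M N h => ?_) fun α => ⟨Finset.univ.sup α, ?_⟩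
  · exact Fintype.piFinset_subset _ _ fun _ => Finset.range_subset_range.2 (by omega)
  · simp only [Fintype.mem_piFinset, Finset.mem_range, Nat.lt_succ_iff]
    exact fun j => Finset.le_sup (Finset.mem_univ j)

lemma summable_prod_pow {q : Fin n → ℝ} (h0 : ∀ j, 0 ≤ q j) (h1 : ∀ j, q j < 1) :
    Summable fun α : Fin n → ℕ => ∏ j, q j ^ α j := by
  refine summable_of_sum_le (c := ∏ j, (1 - q j)⁻¹)
    (fun α => Finset.prod_nonneg fun j _ => pow_nonneg (h0 j) _) fun s => ?_
  obtain ⟨N, hN⟩ := (tendsto_piFinset_range_atTop.eventually (eventually_ge_atTop s)).exists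
  refine (Finset.sum_le_sum_of_subset_of_nonneg hN fun α _ _ =>
    Finset.prod_nonneg fun j _ => pow_nonneg (h0 j) _).trans ?_
  rw [← Finset.prod_univ_sum (fun _ => Finset.range (N + 1)) fun j k => q j ^ k]
  refine Finset.prod_le_prod (fun j _ => Finset.sum_nonneg fun k _ => pow_nonneg (h0 j) _)
    fun j _ => ?_
  rw [← tsum_geometric_of_lt_one (h0 j) (h1 j)]
  exact (summable_geometric_of_lt_one (h0 j) (h1 j)).sum_le_tsum _ fun k _ => pow_nonneg (h0 j) _

/-- The Taylor coefficients at the origin, computed on the torus of multiradius `r`. -/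
noncomputable def taylorCoeff (f : (Fin n → ℂ) → ℂ) (r : Fin n → ℝ) (α : Fin n → ℕ) : ℂ :=
  torusCoeff f (fun j => (r j : ℂ)) α * (∏ j, (r j : ℂ) ^ α j)⁻¹

lemma taylorCoeff_mul_prod_pow (f : (Fin n → ℂ) → ℂ) {r : Fin n → ℝ} (hr : ∀ j, 0 < r j)
    (α : Fin n → ℕ) :
    taylorCoeff f r α * ∏ j, (r j : ℂ) ^ α j = torusCoeff f (fun j => (r j : ℂ)) α :=
  inv_mul_cancel_right₀ (Finset.prod_ne_zero_iff.2 fun j _ =>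
    pow_ne_zero _ (by exact_mod_cast (hr j).ne')) _

lemma norm_sum_pow_le {q : ℝ} (hq : q < 1) {u : ℂ} (hu : ‖u‖ ≤ q) (N : ℕ) :
    ‖∑ k ∈ Finset.range (N + 1), u ^ k‖ ≤ (1 - q)⁻¹ := by
  have h0 : 0 ≤ q := (norm_nonneg _).trans hu
  refine (norm_sum_le _ _).trans ?_
  rw [← tsum_geometric_of_lt_one h0 hq]
  refine le_trans (Finset.sum_le_sum fun k _ => ?_)
    ((summable_geometric_of_lt_one h0 hq).sum_le_tsum _ fun k _ => pow_nonneg h0 _)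
  rw [norm_pow]
  exact pow_le_pow_left₀ (norm_nonneg _) hu k

namespace IsBoundedCompleteReinhardtDomain

variable {R : Set (Fin n → ℂ)} {f : (Fin n → ℂ) → ℂ}

lemma tendsto_squarePartialSum_taylorCoeff (hR : IsBoundedCompleteReinhardtDomain R)
    (hf : DifferentiableOn ℂ f R) {r : Fin n → ℝ} (hr : (fun j => (r j : ℂ)) ∈ R)
    {z : Fin n → ℂ} (hz : ∀ j, ‖z j‖ < r j) :
    Tendsto (fun N => squarePartialSum (taylorCoeff f r) N z) atTop (𝓝 (f z)) := by
  have hr0 : ∀ j, 0 < r j := fun j => (norm_nonneg _).trans_lt (hz j)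
  have hrc : ∀ j, (r j : ℂ) ≠ 0 := fun j => by exact_mod_cast (hr0 j).ne'
  have hfc := hR.continuous_comp_rotate hf.continuousOn hr
  have hu : ∀ j (t : UnitAddCircle), z j / r j * (unitExp t)⁻¹ = z j / (unitExp t * r j) := by
    intro j t
    have := hrc j
    have := unitExp_ne_zero t
    field_simp
  have hS : ∀ N, squarePartialSum (taylorCoeff f r) N z =
      ∫ x : Fin n → UnitAddCircle, f (rotate x fun j => (r j : ℂ)) *
        ∏ j, ∑ k ∈ Finset.range (N + 1), (z j / (unitExp (x j) * r j)) ^ k := by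
    intro N
    have := squarePartialSum_eq_integral hfc (taylorCoeff_mul_prod_pow f hr0) N
      (fun j => z j / r j)
    simp only [div_mul_cancel₀ _ (hrc _), hu] at this
    exact this
  have hn : ∀ j (t : UnitAddCircle), ‖z j / (unitExp t * r j)‖ ≤ ‖z j‖ / r j :=
    fun j t => (norm_div_unitExp_mul (hr0 j) _ _).le
  have hlt : ∀ j, ‖z j‖ / r j < 1 := fun j => (div_lt_one (hr0 j)).2 (hz j)
  have hcd : ∀ j, Continuous fun x : Fin n → UnitAddCircle => z j / (unitExp (x j) * r j) :=
    fun j => continuous_const.div (by fun_prop) fun x => mul_ne_zero (unitExp_ne_zero _) (hrc j)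
  simp_rw [hS]
  rw [← hR.integral_mul_prod_inv_one_sub_div hf hr hz]
  refine tendsto_integral_of_dominated_convergence
    (fun x => ‖f (rotate x fun j => (r j : ℂ))‖ * ∏ j, (1 - ‖z j‖ / r j)⁻¹) (fun N => ?_)
    (integrable_of_continuous (hfc.norm.mul continuous_const)) (fun N => ?_) ?_
  · exact (hfc.mul (continuous_finsetProd _ fun j _ => continuous_finsetSum _ fun k _ =>
      (hcd j).pow k)).aestronglyMeasurable
  · refine Eventually.of_forall fun x => ?_
    rw [norm_mul, norm_prod]
    gcongr with j
    exact norm_sum_pow_le (hlt j) (hn j _) N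
  · refine Eventually.of_forall fun x => Tendsto.const_mul _ (tendsto_finsetProd _ fun j _ => ?_)
    exact (hasSum_geometric_of_norm_lt_one ((hn j _).trans_lt (hlt j))).tendsto_sum_nat.comp
      (tendsto_add_atTop_nat 1)

lemma hasSumUniformlyOn_taylorCoeff (hR : IsBoundedCompleteReinhardtDomain R)
    (hf : DifferentiableOn ℂ f R) {r ρ : Fin n → ℝ} (hr : (fun j => (r j : ℂ)) ∈ R)
    (hρ0 : ∀ j, 0 ≤ ρ j) (hρ : ∀ j, ρ j < r j) :
    HasSumUniformlyOn (fun (α : Fin n → ℕ) (z : Fin n → ℂ) => taylorCoeff f r α * ∏ j, z j ^ α j)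
      f {z | ∀ j, ‖z j‖ ≤ ρ j} := by
  have hr0 : ∀ j, 0 < r j := fun j => (hρ0 j).trans_lt (hρ j)
  have hfc := hR.continuous_comp_rotate hf.continuousOn hr
  have hq0 : ∀ j, 0 ≤ ρ j / r j := fun j => div_nonneg (hρ0 j) (hr0 j).le
  have hq1 : ∀ j, ρ j / r j < 1 := fun j => (div_lt_one (hr0 j)).2 (hρ j)
  have hu := HasSumUniformlyOn.of_norm_le_summable
    (f := fun (α : Fin n → ℕ) (z : Fin n → ℂ) => taylorCoeff f r α * ∏ j, z j ^ α j)
    (s := {z | ∀ j, ‖z j‖ ≤ ρ j})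
    ((summable_prod_pow hq0 hq1).mul_left (∫ x, ‖f (rotate x fun j => (r j : ℂ))‖)) ?_
  · refine hu.congr_right fun z hz => ?_
    have h1 := (hu.hasSum hz).comp tendsto_piFinset_range_atTop
    exact tendsto_nhds_unique h1
      (hR.tendsto_squarePartialSum_taylorCoeff hf hr fun j => (hz j).trans_lt (hρ j))
  · intro α z hz
    have h1 : ‖torusCoeff f (fun j => (r j : ℂ)) α‖ ≤
        ∫ x, ‖f (rotate x fun j => (r j : ℂ))‖ := by
      refine (norm_integral_le_integral_norm _).trans (le_of_eq ?_)
      simp_rw [norm_mul, norm_prod_inv_unitExp_pow, mul_one]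
    rw [taylorCoeff, mul_assoc, norm_mul]
    gcongr
    rw [← Finset.prod_inv_distrib, ← Finset.prod_mul_distrib, norm_prod]
    gcongr with j
    rw [norm_mul, norm_inv, norm_pow, norm_pow, Complex.norm_real, Real.norm_of_nonneg (hr0 j).le,
      div_pow, div_eq_inv_mul]
    exact mul_le_mul_of_nonneg_left (pow_le_pow_left₀ (norm_nonneg _) (hz j) _)
      (inv_nonneg.2 (pow_nonneg (hr0 j).le _))

/-- The Taylor coefficients do not depend on the torus they are computed on: on a torus inside both
polydiscs the two expansions agree. -/
lemma taylorCoeff_eq (hR : IsBoundedCompleteReinhardtDomain R)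
    (hf : DifferentiableOn ℂ f R) {r r' : Fin n → ℝ} (hr : (fun j => (r j : ℂ)) ∈ R)
    (hr' : (fun j => (r' j : ℂ)) ∈ R) (h0 : ∀ j, 0 < r j) (h0' : ∀ j, 0 < r' j) :
    taylorCoeff f r = taylorCoeff f r' := by
  set ρ : Fin n → ℝ := fun j => min (r j) (r' j) / 2
  have hρ0 : ∀ j, 0 < ρ j := fun j => half_pos (lt_min (h0 j) (h0' j))
  have hρr : ∀ j, ρ j < r j := fun j =>
    (half_lt_self (lt_min (h0 j) (h0' j))).trans_le (min_le_left _ _)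
  have hρr' : ∀ j, ρ j < r' j := fun j =>
    (half_lt_self (lt_min (h0 j) (h0' j))).trans_le (min_le_right _ _)
  have hρR : (fun j => (ρ j : ℂ)) ∈ R := hR.mem_of_norm_lt hr fun j => by
    simpa [abs_of_pos (hρ0 j), abs_of_pos (h0 j)] using hρr j
  have hsub : (Set.range fun x => rotate x fun j => (ρ j : ℂ)) ⊆ {z | ∀ j, ‖z j‖ ≤ ρ j} := by
    rintro _ ⟨x, rfl⟩ j
    simp [abs_of_pos (hρ0 j)]
  have hc := hR.continuous_comp_rotate hf.continuousOn hρR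
  ext α
  refine mul_right_cancel₀ (b := ∏ j, (ρ j : ℂ) ^ α j) (Finset.prod_ne_zero_iff.2 fun j _ =>
    pow_ne_zero _ (by exact_mod_cast (hρ0 j).ne')) ?_
  rw [mul_prod_pow_eq_torusCoeff hc
      ((hR.hasSumUniformlyOn_taylorCoeff hf hr (fun j => (hρ0 j).le) hρr).mono hsub),
    mul_prod_pow_eq_torusCoeff hc
      ((hR.hasSumUniformlyOn_taylorCoeff hf hr' (fun j => (hρ0 j).le) hρr').mono hsub)]

lemma exists_isPowerSeriesExpansion (hR : IsBoundedCompleteReinhardtDomain R)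
    (hf : DifferentiableOn ℂ f R) : ∃ b, IsPowerSeriesExpansion R f b := by
  obtain ⟨r, hr0, hr⟩ := hR.exists_ofReal_mem_gt hR.zero_mem
  simp only [Pi.zero_apply, norm_zero] at hr0
  refine ⟨taylorCoeff f r, fun K hK hKc => ?_⟩
  refine hasSumUniformlyOn_iff_tendstoUniformlyOn.2
    ((tendstoLocallyUniformlyOn_iff_tendstoUniformlyOn_of_compact hKc).1
      (hasSumLocallyUniformlyOn_of_of_forall_exists_nhds fun z hz => ?_))
  obtain ⟨r', hr'z, hr'⟩ := hR.exists_ofReal_mem_gt (hK hz)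
  have hr'0 : ∀ j, 0 < r' j := fun j => (norm_nonneg _).trans_lt (hr'z j)
  choose ρ hzρ hρr using fun j => exists_between (hr'z j)
  refine ⟨{z | ∀ j, ‖z j‖ ≤ ρ j}, mem_nhdsWithin_of_mem_nhds ?_, ?_⟩
  · have : IsOpen {w : Fin n → ℂ | ∀ j, ‖w j‖ < ρ j} := by
      simp only [Set.ofPred_forall]
      exact isOpen_iInter_of_finite fun j => isOpen_lt (by fun_prop) continuous_const
    exact mem_of_superset (this.mem_nhds hzρ) fun w hw j => (hw j).le
  · rw [hR.taylorCoeff_eq hf hr hr' hr0 hr'0]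
    exact hR.hasSumUniformlyOn_taylorCoeff hf hr'
      (fun j => (norm_nonneg _).trans (hzρ j).le) hρr

lemma isCompact_range_rotate (z : Fin n → ℂ) : IsCompact (Set.range fun x => rotate x z) :=
  isCompact_range (continuous_rotate_left z)

lemma range_rotate_subset (hR : IsBoundedCompleteReinhardtDomain R) {z : Fin n → ℂ} (hz : z ∈ R) :
    (Set.range fun x => rotate x z) ⊆ R := by
  rintro _ ⟨x, rfl⟩
  exact hR.rotate_mem hz x

lemma mul_prod_pow_eq_torusCoeff (hR : IsBoundedCompleteReinhardtDomain R)
    (hf : ContinuousOn f R) {b : (Fin n → ℕ) → ℂ} (hb : IsPowerSeriesExpansion R f b)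
    {w : Fin n → ℂ} (hw : w ∈ R) (α : Fin n → ℕ) :
    b α * ∏ j, w j ^ α j = torusCoeff f w α :=
  _root_.mul_prod_pow_eq_torusCoeff (hR.continuous_comp_rotate hf hw)
    (hb _ (hR.range_rotate_subset hw) (isCompact_range_rotate w)) α

lemma isPowerSeriesExpansion_unique (hR : IsBoundedCompleteReinhardtDomain R)
    (hf : ContinuousOn f R) {b b' : (Fin n → ℕ) → ℂ} (hb : IsPowerSeriesExpansion R f b)
    (hb' : IsPowerSeriesExpansion R f b') : b = b' := by
  obtain ⟨r, hr0, hr⟩ := hR.exists_ofReal_mem_gt hR.zero_mem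
  simp only [Pi.zero_apply, norm_zero] at hr0
  ext α
  refine mul_right_cancel₀ (b := ∏ j, (r j : ℂ) ^ α j) (Finset.prod_ne_zero_iff.2 fun j _ =>
    pow_ne_zero _ (by exact_mod_cast (hr0 j).ne')) ?_
  rw [hR.mul_prod_pow_eq_torusCoeff hf hb hr, hR.mul_prod_pow_eq_torusCoeff hf hb' hr]

end IsBoundedCompleteReinhardtDomain

/-! ### Uniform bounds for square partial sums on tori -/

/-- Near `t = 0` the distance of `(1 - a) e^{2πit}` to `1` is comparable to `a + |t|`. -/
lemma le_norm_one_sub_mul_unitExp {a θ : ℝ} (ha0 : 0 ≤ a) (ha : a ≤ 1 / 2) (hθ : |θ| ≤ 1 / 2) :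
    (a + |θ|) / 2 ≤ ‖1 - ((1 - a : ℝ) : ℂ) * unitExp (θ : UnitAddCircle)‖ := by
  have hpi := Real.pi_pos
  have hcos : Real.cos (2 * Real.pi * θ) ≤ 1 - 8 * θ ^ 2 := by
    refine (Real.cos_le_one_sub_mul_cos_sq (x := 2 * Real.pi * θ) ?_).trans (le_of_eq ?_)
    · rw [abs_mul, abs_of_pos (by positivity)]
      nlinarith
    · field_simp
      ring
  have hsq : ‖1 - ((1 - a : ℝ) : ℂ) * unitExp (θ : UnitAddCircle)‖ ^ 2 =
      a ^ 2 + 2 * (1 - a) * (1 - Real.cos (2 * Real.pi * θ)) := by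
    rw [unitExp_coe, ← Complex.normSq_eq_norm_sq, Complex.normSq_apply]
    simp only [Complex.sub_re, Complex.one_re, Complex.re_ofReal_mul, Complex.exp_ofReal_mul_I_re,
      Complex.sub_im, Complex.one_im, Complex.im_ofReal_mul, Complex.exp_ofReal_mul_I_im]
    nlinarith [Real.sin_sq_add_cos_sq (2 * Real.pi * θ)]
  refine abs_le_of_sq_le_sq' ?_ (norm_nonneg _) |>.2
  rw [hsq]
  have h1 : 8 * |θ| ^ 2 ≤ 1 - Real.cos (2 * Real.pi * θ) := by rw [sq_abs]; linarith
  nlinarith [sq_nonneg (a - |θ|), sq_nonneg θ, sq_nonneg |θ|, abs_nonneg θ]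

lemma norm_sum_pow_unitExp_le {a θ : ℝ} (ha0 : 0 < a) (ha : a ≤ 1 / 2) (hθ : |θ| ≤ 1 / 2)
    (N : ℕ) :
    ‖∑ k ∈ Finset.range (N + 1), (((1 - a : ℝ) : ℂ) * unitExp (θ : UnitAddCircle)) ^ k‖ ≤
      4 * (a + |θ|)⁻¹ := by
  set u : ℂ := ((1 - a : ℝ) : ℂ) * unitExp (θ : UnitAddCircle) with hu
  have hpos : 0 < a + |θ| := by positivity
  have h1 := le_norm_one_sub_mul_unitExp ha0.le ha hθ
  rw [← hu] at h1
  -- The numerator of the truncated geometric series `(1 - u ^ (N + 1)) / (1 - u)`.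
  have h2 : ‖1 - u ^ (N + 1)‖ ≤ 2 := by
    refine (norm_sub_le _ _).trans ?_
    have : ‖u‖ ≤ 1 := by
      rw [hu, norm_mul, norm_unitExp, mul_one, Complex.norm_real, Real.norm_of_nonneg] <;> linarith
    rw [norm_one, norm_pow]
    linarith [pow_le_one₀ (norm_nonneg u) this (n := N + 1)]
  have h3 : ‖∑ k ∈ Finset.range (N + 1), u ^ k‖ * ‖1 - u‖ ≤ 2 := by
    rwa [← norm_mul, geom_sum_mul_neg]
  rw [← div_eq_mul_inv, le_div_iff₀ hpos]
  nlinarith [norm_nonneg (∑ k ∈ Finset.range (N + 1), u ^ k)]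

/-- The truncated geometric series has `L¹` norm `O(log (1/a))` on the circle of radius `1 - a`,
uniformly in the order of truncation. -/
lemma integral_norm_sum_pow_unitExp_le {a : ℝ} (ha0 : 0 < a) (ha : a ≤ 1 / 2) (N : ℕ) :
    ∫ t : UnitAddCircle, ‖∑ k ∈ Finset.range (N + 1), (((1 - a : ℝ) : ℂ) * unitExp t) ^ k‖ ≤
      8 * Real.log a⁻¹ := by
  have hcont : Continuous fun θ : ℝ =>
      ‖∑ k ∈ Finset.range (N + 1), (((1 - a : ℝ) : ℂ) * unitExp (θ : UnitAddCircle)) ^ k‖ := by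
    have : Continuous fun θ : ℝ => unitExp (θ : UnitAddCircle) :=
      continuous_unitExp.comp (AddCircle.continuous_mk' 1)
    fun_prop
  have hi : IntervalIntegrable (fun θ => 4 * (a + θ)⁻¹) volume 0 (1 / 2) := by
    refine ContinuousOn.intervalIntegrable fun θ hθ => ?_
    rw [Set.uIcc_of_le (by norm_num)] at hθ
    have : a + θ ≠ 0 := by linarith [hθ.1]
    exact ContinuousAt.continuousWithinAt (by fun_prop (disch := assumption))
  have hval : ∫ θ in (0 : ℝ)..1 / 2, 4 * (a + θ)⁻¹ ≤ 4 * Real.log a⁻¹ := by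
    rw [intervalIntegral.integral_const_mul,
      intervalIntegral.integral_comp_add_left (fun θ => θ⁻¹) a,
      integral_inv_of_pos (by linarith) (by linarith), add_zero]
    gcongr
    rw [div_eq_mul_inv]
    exact mul_le_of_le_one_left (by positivity) (by linarith)
  have hright : ∫ θ in (0 : ℝ)..1 / 2,
      ‖∑ k ∈ Finset.range (N + 1), (((1 - a : ℝ) : ℂ) * unitExp (θ : UnitAddCircle)) ^ k‖ ≤
        4 * Real.log a⁻¹ := by
    refine (intervalIntegral.integral_mono_on (by norm_num) (hcont.intervalIntegrable _ _) hi
      fun θ hθ => ?_).trans hval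
    have := norm_sum_pow_unitExp_le ha0 ha (θ := θ) (by rw [abs_of_nonneg hθ.1]; exact hθ.2) N
    rwa [abs_of_nonneg hθ.1] at this
  have hleft : ∫ θ in (-(1 / 2) : ℝ)..0,
      ‖∑ k ∈ Finset.range (N + 1), (((1 - a : ℝ) : ℂ) * unitExp (θ : UnitAddCircle)) ^ k‖ ≤
        4 * Real.log a⁻¹ := by
    have h0 := intervalIntegral.integral_comp_neg (a := 0) (b := 1 / 2) (fun θ : ℝ =>
      ‖∑ k ∈ Finset.range (N + 1), (((1 - a : ℝ) : ℂ) * unitExp (θ : UnitAddCircle)) ^ k‖)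
    rw [neg_zero] at h0
    rw [← h0]
    refine (intervalIntegral.integral_mono_on (by norm_num)
      ((hcont.comp continuous_neg).intervalIntegrable _ _) hi fun θ hθ => ?_).trans hval
    have := norm_sum_pow_unitExp_le ha0 ha (θ := -θ)
      (by rw [abs_neg, abs_of_nonneg hθ.1]; exact hθ.2) N
    rwa [abs_neg, abs_of_nonneg hθ.1] at this
  rw [← UnitAddCircle.intervalIntegral_preimage (-(1 / 2)), show (-(1 / 2) + 1 : ℝ) = 1 / 2 by
    norm_num, ← intervalIntegral.integral_add_adjacent_intervals (b := 0)
      (hcont.intervalIntegrable _ _) (hcont.intervalIntegrable _ _)]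
  linarith

lemma integral_norm_sum_pow_unitExp_dyadic_le (k N : ℕ) :
    ∫ t : UnitAddCircle,
        ‖∑ i ∈ Finset.range (N + 1), (((1 - (1 / 2) ^ (k + 1) : ℝ) : ℂ) * unitExp t) ^ i‖ ≤
      8 * (k + 1) := by
  refine (integral_norm_sum_pow_unitExp_le (by positivity) ?_ N).trans ?_
  · rw [pow_succ]
    exact mul_le_of_le_one_left (by norm_num) (pow_le_one₀ (by norm_num) (by norm_num))
  · rw [← inv_pow, Real.log_pow]
    have : Real.log (1 / 2)⁻¹ ≤ 1 := by
      rw [one_div, inv_inv]; linarith [Real.log_two_lt_d9]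
    push_cast
    nlinarith

/-- Young's inequality for the square partial sums: passing from the torus through `w` to the
smaller one through `q w` costs the `L¹` norm of the truncated geometric series in each variable. -/
lemma lintegral_squarePartialSum_rotate_le {f : (Fin n → ℂ) → ℂ} {b : (Fin n → ℕ) → ℂ}
    {w : Fin n → ℂ} (hf : Continuous fun x => f (rotate x w))
    (hb : ∀ α, b α * ∏ j, w j ^ α j = torusCoeff f w α) (N : ℕ) (q : ℝ) :
    ∫⁻ y, ‖squarePartialSum b N (rotate y (q • w))‖ₑ ≤
      ENNReal.ofReal ((∫ t : UnitAddCircle,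
          ‖∑ k ∈ Finset.range (N + 1), ((q : ℂ) * unitExp t) ^ k‖) ^ n) *
        ∫⁻ x, ‖f (rotate x w)‖ₑ := by
  set H : (Fin n → UnitAddCircle) → ℂ := fun x =>
    ∏ j, ∑ k ∈ Finset.range (N + 1), ((q : ℂ) * unitExp (x j)) ^ k with hH
  have hHc : Continuous H := by rw [hH]; fun_prop
  have hHint : ∫⁻ x, ‖H x‖ₑ = ENNReal.ofReal ((∫ t : UnitAddCircle,
      ‖∑ k ∈ Finset.range (N + 1), ((q : ℂ) * unitExp t) ^ k‖) ^ n) := by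
    rw [← ofReal_integral_norm_eq_lintegral_enorm (integrable_of_continuous hHc)]
    simp_rw [hH, norm_prod]
    rw [integral_fintype_prod_volume_eq_pow (fun t : UnitAddCircle =>
      ‖∑ k ∈ Finset.range (N + 1), ((q : ℂ) * unitExp t) ^ k‖), Fintype.card_fin]
  have hS : ∀ y, squarePartialSum b N (rotate y (q • w)) =
      ∫ x : Fin n → UnitAddCircle, f (rotate x w) * H (y - x) := by
    intro y
    have := squarePartialSum_eq_integral hf hb N (fun j => q * unitExp (y j))
    have h2 : rotate y (q • w) = fun j => (q * unitExp (y j)) * w j := by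
      ext j
      simp only [rotate_apply, Pi.smul_apply, Complex.real_smul]
      ring
    rw [h2, this, hH]
    simp only [Pi.sub_apply, unitExp_sub, mul_assoc]
  calc ∫⁻ y, ‖squarePartialSum b N (rotate y (q • w))‖ₑ
      ≤ ∫⁻ y, ∫⁻ x, ‖f (rotate x w)‖ₑ * ‖H (y - x)‖ₑ := by
        refine lintegral_mono fun y => ?_
        rw [hS]
        refine (enorm_integral_le_lintegral_enorm _).trans_eq ?_
        simp_rw [enorm_mul]
    _ = ∫⁻ x, ∫⁻ y, ‖f (rotate x w)‖ₑ * ‖H (y - x)‖ₑ := by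
        refine lintegral_lintegral_swap (Continuous.aemeasurable ?_)
        have h1 : Continuous fun p : (Fin n → UnitAddCircle) × (Fin n → UnitAddCircle) =>
          f (rotate p.2 w) * H (p.1 - p.2) := (hf.comp continuous_snd).mul
            (hHc.comp (continuous_fst.sub continuous_snd))
        refine h1.enorm.congr fun p => ?_
        rw [enorm_mul]; rfl
    _ = ∫⁻ x, ‖f (rotate x w)‖ₑ * ∫⁻ y, ‖H y‖ₑ := by
        refine lintegral_congr fun x => ?_
        have hm : Measurable fun y => ‖H (y - x)‖ₑ :=
          (hHc.comp (continuous_sub_right x)).enorm.measurable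
        rw [lintegral_const_mul _ hm, lintegral_sub_right_eq_self (fun y => ‖H y‖ₑ) x]
    _ = _ := by
        rw [lintegral_mul_const _ hf.enorm.measurable, hHint, mul_comm]

/-! ### Hardy and Bergman norms as averages over tori -/

lemma exists_unitExp_mul_norm_eq (z : ℂ) : ∃ t : UnitAddCircle, unitExp t * ‖z‖ = z := by
  refine ⟨((z.arg / (2 * Real.pi) : ℝ) : UnitAddCircle), ?_⟩
  rw [unitExp_coe, mul_div_cancel₀ _ Real.two_pi_pos.ne', mul_comm]
  exact Complex.norm_mul_exp_arg_mul_I z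

lemma measurePreserving_mk_pi : MeasurePreserving
    (fun (θ : Fin n → ℝ) (j : Fin n) => (θ j : UnitAddCircle))
    (volume.restrict (Set.univ.pi fun _ => Set.Ioc (0 : ℝ) (0 + 1))) volume := by
  have := measurePreserving_pi (fun _ : Fin n => volume.restrict (Set.Ioc (0 : ℝ) (0 + 1)))
    (fun _ : Fin n => (volume : Measure UnitAddCircle))
    (fun _ => UnitAddCircle.measurePreserving_mk 0)
  rwa [← Measure.restrict_pi_pi] at this

/-- The normalised `L¹` norm on a torus is at most the unnormalised one, whose angles run through
`[0, 2π]ⁿ`. -/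
lemma lintegral_rotate_le_lintegral_torusMap {f : (Fin n → ℂ) → ℂ} {r : Fin n → ℝ}
    (hf : Continuous fun x => f (rotate x fun j => (r j : ℂ))) :
    ∫⁻ x, ‖f (rotate x fun j => (r j : ℂ))‖ₑ ≤
      ∫⁻ θ in Set.Icc (0 : Fin n → ℝ) (fun _ => 2 * Real.pi), ‖f (torusMap 0 r θ)‖ₑ := by
  have hpi := Real.two_pi_pos
  set S : Set (Fin n → ℝ) := Set.univ.pi fun _ => Set.Ioc (0 : ℝ) (0 + 1) with hS
  set T : Set (Fin n → ℝ) := Set.Icc (0 : Fin n → ℝ) (fun _ => 2 * Real.pi) with hT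
  set g : (Fin n → ℝ) → ℝ≥0∞ := fun θ => ‖f (torusMap 0 r θ)‖ₑ with hg
  have hmap : ∀ θ : Fin n → ℝ,
      (rotate (fun j => ((θ j / (2 * Real.pi) : ℝ) : UnitAddCircle)) fun j => (r j : ℂ)) =
        torusMap 0 r θ := by
    intro θ
    ext j
    rw [rotate_apply, unitExp_coe, mul_div_cancel₀ _ hpi.ne', torusMap]
    simp [mul_comm]
  have hgm : Measurable g := by
    have h1 : Continuous fun θ : Fin n → ℝ =>
        f (rotate (fun j => ((θ j / (2 * Real.pi) : ℝ) : UnitAddCircle)) fun j => (r j : ℂ)) :=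
      hf.comp (continuous_pi fun j => (AddCircle.continuous_mk' 1).comp (by fun_prop))
    simp_rw [hmap] at h1
    exact h1.enorm.measurable
  have hSm : MeasurableSet S := MeasurableSet.univ_pi fun _ => measurableSet_Ioc
  -- The Jacobian of `θ ↦ 2πθ`; its inverse is at most `1`.
  have hcoef : ENNReal.ofReal |((2 * Real.pi) ^ Module.finrank ℝ (Fin n → ℝ))⁻¹| ≤ 1 := by
    rw [ENNReal.ofReal_le_one, abs_of_nonneg (by positivity)]
    exact inv_le_one_of_one_le₀ (one_le_pow₀ (by linarith [Real.pi_gt_three]))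
  calc ∫⁻ x, ‖f (rotate x fun j => (r j : ℂ))‖ₑ
      = ∫⁻ θ in S, g ((2 * Real.pi) • θ) := by
        rw [← measurePreserving_mk_pi.lintegral_comp hf.enorm.measurable]
        refine lintegral_congr fun θ => ?_
        rw [hg]
        simp only
        rw [← hmap]
        simp only [Pi.smul_apply, smul_eq_mul, mul_div_cancel_left₀ _ hpi.ne']
    _ ≤ ∫⁻ θ, T.indicator g ((2 * Real.pi) • θ) := by
        rw [← lintegral_indicator hSm]
        refine lintegral_mono fun θ => ?_
        by_cases hθ : θ ∈ S
        swap
        · simp [hθ]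
        rw [Set.indicator_of_mem hθ, Set.indicator_of_mem]
        rw [hS, Set.mem_univ_pi] at hθ
        refine ⟨fun j => ?_, fun j => ?_⟩
        · exact mul_nonneg hpi.le (hθ j).1.le
        · exact mul_le_of_le_one_right hpi.le (by simpa using (hθ j).2)
    _ = ∫⁻ θ, T.indicator g θ ∂(Measure.map ((2 * Real.pi) • ·) volume) :=
        (lintegral_map (hgm.indicator measurableSet_Icc) (measurable_const_smul _)).symm
    _ ≤ ∫⁻ θ, T.indicator g θ := by
        rw [Measure.map_addHaar_smul _ hpi.ne', lintegral_smul_measure]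
        exact mul_le_of_le_one_left' hcoef
    _ = ∫⁻ θ in T, g θ := lintegral_indicator measurableSet_Icc _

namespace IsBoundedCompleteReinhardtDomain

variable {R : Set (Fin n → ℂ)} {f : (Fin n → ℂ) → ℂ}

/-- The tori in `torusRadii` have real multiradii; the torus through a general `w` is a translate of
one of them. -/
lemma lintegral_rotate_le_hardyNorm (hR : IsBoundedCompleteReinhardtDomain R)
    (hf : ContinuousOn f R) {w : Fin n → ℂ} (hw : w ∈ R) (hw0 : ∀ j, w j ≠ 0) :
    ∫⁻ x, ‖f (rotate x w)‖ₑ ≤ hardyNorm R f := by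
  set r : Fin n → ℝ := fun j => ‖w j‖ with hr
  have hrR : (fun j => (r j : ℂ)) ∈ R := hR.mem_of_norm_le hw fun j => by simp [hr]
  choose y hy using fun j => exists_unitExp_mul_norm_eq (w j)
  have hwy : w = rotate y fun j => (r j : ℂ) := by
    ext j; exact (hy j).symm
  have hc := hR.continuous_comp_rotate hf hrR
  have hmem : r ∈ torusRadii R :=
    ⟨fun j => norm_pos_iff.2 (hw0 j), fun z hz => hR.mem_of_norm_le hw fun j => (hz j).le⟩
  calc ∫⁻ x, ‖f (rotate x w)‖ₑ
      = ∫⁻ x, ‖f (rotate (x + y) fun j => (r j : ℂ))‖ₑ := by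
        simp_rw [rotate_add, ← hwy]
    _ = ∫⁻ x, ‖f (rotate x fun j => (r j : ℂ))‖ₑ :=
        lintegral_add_right_eq_self (fun x => ‖f (rotate x fun j => (r j : ℂ))‖ₑ) y
    _ ≤ _ := lintegral_rotate_le_lintegral_torusMap hc
    _ ≤ hardyNorm R f := le_iSup₂_of_le r hmem le_rfl

/-- Functions are arbitrary outside `R`, so that measurability only holds after cutting off. -/
lemma measurable_indicator_enorm (hR : IsBoundedCompleteReinhardtDomain R) {g : (Fin n → ℂ) → ℂ}
    (hg : ContinuousOn g R) : Measurable (R.indicator fun z => ‖g z‖ₑ) := by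
  classical
  rw [← Set.piecewise_eq_indicator]
  exact ContinuousOn.measurable_piecewise hg.enorm continuousOn_const hR.isOpen.measurableSet

lemma indicator_rotate (hR : IsBoundedCompleteReinhardtDomain R) (g : (Fin n → ℂ) → ℂ)
    (x : Fin n → UnitAddCircle) (z : Fin n → ℂ) :
    R.indicator (fun z => ‖g z‖ₑ) (rotate x z) = R.indicator (fun z => ‖g (rotate x z)‖ₑ) z := by
  by_cases hz : z ∈ R
  · rw [Set.indicator_of_mem hz, Set.indicator_of_mem (hR.rotate_mem hz x)]
  · rw [Set.indicator_of_notMem hz, Set.indicator_of_notMem fun h => hz ((hR.rotate_mem_iff x).1 h)]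

lemma bergmanNorm_eq_lintegral_lintegral_rotate (hR : IsBoundedCompleteReinhardtDomain R)
    {g : (Fin n → ℂ) → ℂ} (hg : ContinuousOn g R) :
    bergmanNorm R g = ∫⁻ z in R, ∫⁻ x, ‖g (rotate x z)‖ₑ := by
  rw [bergmanNorm, ← lintegral_indicator hR.isOpen.measurableSet,
    lintegral_eq_lintegral_lintegral_rotate (hR.measurable_indicator_enorm hg),
    ← lintegral_indicator hR.isOpen.measurableSet]
  refine lintegral_congr fun z => ?_
  simp_rw [hR.indicator_rotate]
  by_cases hz : z ∈ R <;> simp [hz]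

lemma aemeasurable_lintegral_rotate (hR : IsBoundedCompleteReinhardtDomain R)
    {g : (Fin n → ℂ) → ℂ} (hg : ContinuousOn g R) :
    AEMeasurable (fun z => ∫⁻ x, ‖g (rotate x z)‖ₑ) (volume.restrict R) := by
  refine ⟨fun z => ∫⁻ x, R.indicator (fun z => ‖g z‖ₑ) (rotate x z), ?_, ?_⟩
  · exact ((hR.measurable_indicator_enorm hg).comp continuous_rotate.measurable).lintegral_prod_left'
  · filter_upwards [ae_restrict_mem hR.isOpen.measurableSet] with z hz
    simp_rw [hR.indicator_rotate, Set.indicator_of_mem hz]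

lemma volume_lt_top (hR : IsBoundedCompleteReinhardtDomain R) : volume R < ∞ :=
  hR.isBounded.measure_lt_top

open scoped Pointwise in
/-- The points of the domain outside its dilate of ratio `1 - a` form a set of volume `O(a)`. -/
lemma volume_sdiff_smul_le (hR : IsBoundedCompleteReinhardtDomain R) {a : ℝ} (ha0 : 0 ≤ a)
    (ha1 : a < 1) :
    volume (R \ (1 - a) • R) ≤
      ENNReal.ofReal (Module.finrank ℝ (Fin n → ℂ) * a) * volume R := by
  set d := Module.finrank ℝ (Fin n → ℂ)
  have hq : 0 < 1 - a := by linarith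
  have hsub : (1 - a) • R ⊆ R := by
    rintro _ ⟨z, hz, rfl⟩
    refine hR.mem_of_norm_le hz fun j => ?_
    simp only [Pi.smul_apply, norm_smul, Real.norm_of_nonneg hq.le]
    exact mul_le_of_le_one_left (norm_nonneg _) (by linarith)
  have hmeas : MeasurableSet ((1 - a) • R) := (hR.isOpen.smul₀ hq.ne').measurableSet
  rw [measure_sdiff hsub hmeas.nullMeasurableSet
    ((measure_mono hsub).trans_lt hR.volume_lt_top).ne, Measure.addHaar_smul, tsub_le_iff_right,
    ← add_mul, ← ENNReal.ofReal_add (by positivity) (abs_nonneg _), abs_of_pos (by positivity)]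
  refine le_mul_of_one_le_left' ?_
  rw [ENNReal.one_le_ofReal]
  have := one_add_mul_le_pow (a := -a) (by linarith) d
  rw [show (1 : ℝ) - a = 1 + -a by ring]
  linarith

end IsBoundedCompleteReinhardtDomain

/-- The Hardy norm controls only the tori off the coordinate hyperplanes; by this lemma the other
ones do not matter for integrals. -/
lemma ae_forall_apply_ne_zero : ∀ᵐ z : Fin n → ℂ, ∀ j, z j ≠ 0 := by
  rw [ae_all_iff]
  intro j
  have := Measure.pi_hyperplane (fun _ : Fin n => (volume : Measure ℂ)) j 0
  rw [ae_iff]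
  simpa [volume_pi] using this

/-! ### Convergence in the Bergman norm -/

lemma differentiable_squarePartialSum (b : (Fin n → ℕ) → ℂ) (N : ℕ) :
    Differentiable ℂ (squarePartialSum b N) := by
  unfold squarePartialSum
  fun_prop

namespace IsBoundedCompleteReinhardtDomain

variable {R : Set (Fin n → ℂ)} {f : (Fin n → ℂ) → ℂ}

lemma memBergman_squarePartialSum (hR : IsBoundedCompleteReinhardtDomain R)
    (b : (Fin n → ℕ) → ℂ) (N : ℕ) : MemBergman R (squarePartialSum b N) := by
  refine ⟨(differentiable_squarePartialSum b N).differentiableOn, ?_⟩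
  have h := (differentiable_squarePartialSum b N).continuous.continuousOn.integrableOn_compact
    (μ := volume) hR.isBounded.isCompact_closure
  exact (h.mono_set subset_closure).hasFiniteIntegral

lemma memBergman_of_memHardy (hR : IsBoundedCompleteReinhardtDomain R) (hf : MemHardy R f) :
    MemBergman R f := by
  refine ⟨hf.1, ?_⟩
  rw [hR.bergmanNorm_eq_lintegral_lintegral_rotate hf.1.continuousOn]
  calc ∫⁻ z in R, ∫⁻ x, ‖f (rotate x z)‖ₑ
      ≤ ∫⁻ _ in R, hardyNorm R f := by
        refine lintegral_mono_ae ?_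
        filter_upwards [ae_restrict_mem hR.isOpen.measurableSet,
          ae_restrict_of_ae ae_forall_apply_ne_zero] with z hz hz0
        exact hR.lintegral_rotate_le_hardyNorm hf.1.continuousOn hz hz0
    _ < ∞ := by
        rw [setLIntegral_const]
        exact ENNReal.mul_lt_top hf.2 hR.volume_lt_top

open scoped Pointwise in
/-- On the torus through `z`, the square partial sums grow at most like the `n`-th power of the
logarithm of the distance from `z` to the boundary, uniformly in `N`. -/
lemma lintegral_squarePartialSum_rotate_le (hR : IsBoundedCompleteReinhardtDomain R)
    (hf : ContinuousOn f R) {b : (Fin n → ℕ) → ℂ} (hb : IsPowerSeriesExpansion R f b) (k N : ℕ)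
    {z : Fin n → ℂ} (hz : z ∈ (1 - (1 / 2 : ℝ) ^ (k + 1)) • R) (hz0 : ∀ j, z j ≠ 0) :
    ∫⁻ x, ‖squarePartialSum b N (rotate x z)‖ₑ ≤
      ENNReal.ofReal ((8 * (k + 1)) ^ n) * hardyNorm R f := by
  obtain ⟨w, hw, rfl⟩ := hz
  have hw0 : ∀ j, w j ≠ 0 := fun j h => hz0 j (by simp [h])
  refine (_root_.lintegral_squarePartialSum_rotate_le (hR.continuous_comp_rotate hf hw)
    (hR.mul_prod_pow_eq_torusCoeff hf hb hw) N _).trans ?_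
  gcongr
  · exact integral_norm_sum_pow_unitExp_dyadic_le k N
  · exact hR.lintegral_rotate_le_hardyNorm hf hw hw0

lemma tendsto_lintegral_rotate_sub (hR : IsBoundedCompleteReinhardtDomain R)
    {b : (Fin n → ℕ) → ℂ} (hb : IsPowerSeriesExpansion R f b) {z : Fin n → ℂ} (hz : z ∈ R) :
    Tendsto (fun N => ∫⁻ x, ‖squarePartialSum b N (rotate x z) - f (rotate x z)‖ₑ) atTop
      (𝓝 0) := by
  rw [ENNReal.tendsto_nhds_zero]
  intro ε hε
  obtain ⟨δ, hδ, hδε⟩ := ENNReal.lt_iff_exists_nnreal_btwn.1 hε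
  have hu := Metric.tendstoUniformlyOn_iff.1
    (hb _ (hR.range_rotate_subset hz) (isCompact_range_rotate z)).tendstoUniformlyOn δ
    (by exact_mod_cast hδ)
  filter_upwards [tendsto_piFinset_range_atTop.eventually hu] with N hN
  calc ∫⁻ x, ‖squarePartialSum b N (rotate x z) - f (rotate x z)‖ₑ
      ≤ ∫⁻ _ : Fin n → UnitAddCircle, (δ : ℝ≥0∞) := by
        refine lintegral_mono fun x => ?_
        rw [← edist_eq_enorm_sub, edist_comm, edist_nndist, ENNReal.coe_le_coe]
        exact (hN _ ⟨x, rfl⟩).le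
    _ ≤ ε := by simpa using hδε.le

/-- The factor by which the averages of `|S_N f - f|` over the tori in the dilate of ratio
`1 - 2^{-(k+1)}` can exceed the Hardy norm of `f`. -/
noncomputable def dyadicBound (n k : ℕ) : ℝ := 2 * (8 * (k + 1)) ^ n

lemma summable_dyadicBound (n : ℕ) (d : ℝ) :
    Summable fun k => dyadicBound n (k + 1) * (d * (1 / 2) ^ (k + 1)) := by
  have h := (summable_nat_add_iff 2).2
    (summable_pow_mul_geometric_of_norm_lt_one n (r := (1 / 2 : ℝ)) (by norm_num))
  refine (h.mul_left (4 * d * 8 ^ n)).congr fun k => ?_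
  rw [dyadicBound, mul_pow]
  push_cast
  ring

open scoped Pointwise in
lemma exists_mem_smul (hR : IsBoundedCompleteReinhardtDomain R) {z : Fin n → ℂ} (hz : z ∈ R) :
    ∃ k : ℕ, z ∈ (1 - (1 / 2 : ℝ) ^ (k + 1)) • R := by
  have h1 : Tendsto (fun k : ℕ => 1 - (1 / 2 : ℝ) ^ (k + 1)) atTop (𝓝 (1 - 0)) :=
    ((tendsto_pow_atTop_nhds_zero_of_lt_one (by norm_num) (by norm_num)).comp
      (tendsto_add_atTop_nat 1)).const_sub 1
  rw [sub_zero] at h1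
  have h2 : Tendsto (fun k : ℕ => (1 - (1 / 2 : ℝ) ^ (k + 1))⁻¹ • z) atTop (𝓝 z) := by
    simpa using (h1.inv₀ one_ne_zero).smul_const z
  obtain ⟨k, hk⟩ := (h2.eventually (hR.isOpen.mem_nhds hz)).exists
  refine ⟨k, (Set.mem_smul_set_iff_inv_smul_mem₀ ?_ R z).2 hk⟩
  have : (1 / 2 : ℝ) ^ (k + 1) < 1 := pow_lt_one₀ (by norm_num) (by norm_num) (by omega)
  linarith

open scoped Pointwise in
/-- The integrable majorant, up to the Hardy norm, of all the averages of `|S_N f - f|` over tori: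
it grows logarithmically at the boundary. -/
noncomputable def majorant (R : Set (Fin n → ℂ)) (z : Fin n → ℂ) : ℝ≥0∞ :=
  ENNReal.ofReal (dyadicBound n 0) + ∑' k : ℕ, (R \ (1 - (1 / 2 : ℝ) ^ (k + 1)) • R).indicator
    (fun _ => ENNReal.ofReal (dyadicBound n (k + 1))) z

open scoped Pointwise in
lemma lintegral_majorant_lt_top (hR : IsBoundedCompleteReinhardtDomain R) :
    ∫⁻ z in R, majorant R z < ∞ := by
  have hlt : ∀ k : ℕ, (1 / 2 : ℝ) ^ (k + 1) < 1 := fun k =>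
    pow_lt_one₀ (by norm_num) (by norm_num) (by omega)
  have hm : ∀ k : ℕ, MeasurableSet (R \ (1 - (1 / 2 : ℝ) ^ (k + 1)) • R) := fun k =>
    hR.isOpen.measurableSet.diff
      (hR.isOpen.smul₀ (by linarith [hlt k] : 1 - (1 / 2 : ℝ) ^ (k + 1) ≠ 0)).measurableSet
  have hpos : ∀ k : ℕ, 0 ≤ dyadicBound n k := fun k => by unfold dyadicBound; positivity
  unfold majorant
  rw [lintegral_add_left measurable_const, setLIntegral_const, lintegral_tsum fun k =>
    (measurable_const.indicator (hm k)).aemeasurable]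
  refine ENNReal.add_lt_top.2 ⟨ENNReal.mul_lt_top ENNReal.ofReal_lt_top hR.volume_lt_top, ?_⟩
  set d := Module.finrank ℝ (Fin n → ℂ)
  calc _ ≤ ∑' k : ℕ, ENNReal.ofReal (dyadicBound n (k + 1) * (d * (1 / 2) ^ (k + 1))) *
        volume R := by
        refine ENNReal.tsum_le_tsum fun k => ?_
        rw [lintegral_indicator_const (hm k), ENNReal.ofReal_mul (hpos _), mul_assoc]
        gcongr
        exact (Measure.restrict_apply_le _ _).trans
          (hR.volume_sdiff_smul_le (by positivity) (hlt k))
    _ < ∞ := by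
        rw [ENNReal.tsum_mul_right]
        exact ENNReal.mul_lt_top (summable_dyadicBound n d).tsum_ofReal_lt_top hR.volume_lt_top

open scoped Pointwise in
lemma lintegral_rotate_sub_le (hR : IsBoundedCompleteReinhardtDomain R)
    (hf : ContinuousOn f R) {b : (Fin n → ℕ) → ℂ} (hb : IsPowerSeriesExpansion R f b) (N : ℕ)
    {z : Fin n → ℂ} (hz : z ∈ R) (hz0 : ∀ j, z j ≠ 0) :
    ∫⁻ x, ‖squarePartialSum b N (rotate x z) - f (rotate x z)‖ₑ ≤
      majorant R z * hardyNorm R f := by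
  classical
  have hex := hR.exists_mem_smul hz
  -- The smallest dilate containing `z`: if `k = m + 1`, then `z` lies in the set of index `m` in
  -- the sum defining `majorant`.
  obtain ⟨k, hk, hmin⟩ : ∃ k : ℕ, z ∈ (1 - (1 / 2 : ℝ) ^ (k + 1)) • R ∧
      ∀ m < k, z ∉ (1 - (1 / 2 : ℝ) ^ (m + 1)) • R :=
    ⟨Nat.find hex, Nat.find_spec hex, fun m => Nat.find_min hex⟩
  have hone : (1 : ℝ) ≤ (8 * (k + 1)) ^ n := one_le_pow₀ (by linarith [Nat.cast_nonneg (α := ℝ) k])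
  have h1 : ∫⁻ x, ‖squarePartialSum b N (rotate x z) - f (rotate x z)‖ₑ ≤
      ENNReal.ofReal (dyadicBound n k) * hardyNorm R f := by
    calc _ ≤ ∫⁻ x, (‖squarePartialSum b N (rotate x z)‖ₑ + ‖f (rotate x z)‖ₑ) :=
          lintegral_mono fun x => enorm_sub_le
      _ = (∫⁻ x, ‖squarePartialSum b N (rotate x z)‖ₑ) + ∫⁻ x, ‖f (rotate x z)‖ₑ :=
          lintegral_add_right _ (hR.continuous_comp_rotate hf hz).enorm.measurable
      _ ≤ ENNReal.ofReal ((8 * (k + 1)) ^ n) * hardyNorm R f +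
          ENNReal.ofReal ((8 * (k + 1)) ^ n) * hardyNorm R f := by
          gcongr
          · exact hR.lintegral_squarePartialSum_rotate_le hf hb k N hk hz0
          · exact (hR.lintegral_rotate_le_hardyNorm hf hz hz0).trans
              (le_mul_of_one_le_left' (by simpa using hone))
      _ = _ := by
          rw [← add_mul, ← ENNReal.ofReal_add (by positivity) (by positivity), dyadicBound, two_mul]
  refine h1.trans (mul_le_mul_left ?_ _)
  unfold majorant
  obtain _ | m := k
  · exact le_self_add
  · refine le_add_left (le_trans ?_ (ENNReal.le_tsum m))
    have hmem : z ∈ R \ (1 - (1 / 2 : ℝ) ^ (m + 1)) • R := ⟨hz, hmin m m.lt_succ_self⟩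
    rw [Set.indicator_of_mem hmem]

lemma tendsto_bergmanNorm_squarePartialSum_sub (hR : IsBoundedCompleteReinhardtDomain R)
    (hf : MemHardy R f) {b : (Fin n → ℕ) → ℂ} (hb : IsPowerSeriesExpansion R f b) :
    Tendsto (fun N : ℕ => bergmanNorm R (fun z => squarePartialSum b N z - f z)) atTop (𝓝 0) := by
  have hc : ∀ N, ContinuousOn (fun z => squarePartialSum b N z - f z) R := fun N =>
    (differentiable_squarePartialSum b N).continuous.continuousOn.sub hf.1.continuousOn
  simp_rw [fun N => hR.bergmanNorm_eq_lintegral_lintegral_rotate (hc N)]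
  rw [← lintegral_zero (μ := volume.restrict R)]
  refine tendsto_lintegral_of_dominated_convergence' (fun z => majorant R z * hardyNorm R f)
    (fun N => hR.aemeasurable_lintegral_rotate (hc N)) (fun N => ?_) ?_ ?_
  · filter_upwards [ae_restrict_mem hR.isOpen.measurableSet,
      ae_restrict_of_ae ae_forall_apply_ne_zero] with z hz hz0
    exact hR.lintegral_rotate_sub_le hf.1.continuousOn hb N hz hz0
  · rw [lintegral_mul_const' _ _ hf.2.ne]
    exact (ENNReal.mul_lt_top hR.lintegral_majorant_lt_top hf.2).ne
  · filter_upwards [ae_restrict_mem hR.isOpen.measurableSet] with z hz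
    exact hR.tendsto_lintegral_rotate_sub hb hz

end IsBoundedCompleteReinhardtDomain

end

theorem mainTheorem2 {n : ℕ} (R : Set (Fin n → ℂ)) (hR : IsBoundedCompleteReinhardtDomain R)
    (f : (Fin n → ℂ) → ℂ) (hf : MemHardy R f) :
    (∃! b : (Fin n → ℕ) → ℂ, IsPowerSeriesExpansion R f b) ∧
      ∀ b : (Fin n → ℕ) → ℂ, IsPowerSeriesExpansion R f b →
        MemBergman R f ∧ (∀ N : ℕ, MemBergman R (squarePartialSum b N)) ∧
          Tendsto (fun N : ℕ => bergmanNorm R (fun z => squarePartialSum b N z - f z))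
            atTop (𝓝 0) := by
  obtain ⟨b, hb⟩ := hR.exists_isPowerSeriesExpansion hf.1
  exact ⟨⟨b, hb, fun b' hb' => hR.isPowerSeriesExpansion_unique hf.1.continuousOn hb' hb⟩,
    fun b' hb' => ⟨hR.memBergman_of_memHardy hf, hR.memBergman_squarePartialSum b',
      hR.tendsto_bergmanNorm_squarePartialSum_sub hf hb'⟩⟩
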